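/- Theorem 4.7. Let $S$ be a positive definite (Hermitian) complex $n\times n$ matrix, hence invertible, with eigenvalues $b_1\ge b_2\ge\dots\ge b_n>0$ listed with multiplicity, and let $\mathbf c=(c_i)_{i\in\mathbb N}$ be a bounded sequence of non-negative real numbers. Call the pair $(S,\mathbf c)$ frame admissible if there is a sequence $(f_i)_{i\in\mathbb N}$ in $\mathbb C^n$ such that (a) it is a frame: there are constants $A,B>0$ with $A\|x\|^2\le\sum_{i\in\mathbb N}|\langle x,f_i\rangle|^2\le B\|x\|^2$ for every $x\in\mathbb C^n$; (b) its frame operator is $S$: $Sx=\sum_{i\in\mathbb N}\langle x,f_i\rangle f_i$ for every $x\in\mathbb C^n$; (c) $\|f_i\|^2=c_i$ for every $i\in\mathbb N$. For $k\ge 1$ put $U_k(\mathbf c)=\sup\{\sum_{i\in F}c_i : F\subset\mathbb N,\ |F|=k\}$. Then $(S,\mathbf c)$ is frame admissible if and only if $$\sum_{i=1}^k b_i\ \ge\ U_k(\mathbf c)\quad\text{for every } 1\le k\le n-1,\qquad\text{and}\qquad \sum_{i=1}^n b_i=\sum_{i\in\mathbb N}c_i .$$ -/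

import Mathlib

open scoped ComplexOrder

/-- A family `f` in a complex inner product space `H` is a *frame* if there are `A, B > 0` with
`A ‖x‖² ≤ ∑ k, |⟨x, f k⟩|² ≤ B ‖x‖²` for every `x`. (The upper bound includes the convergence of
the sum of non-negative terms. Mathlib's inner product is conjugate linear in its first argument.) -/
def IsFrame {ι H : Type*} [NormedAddCommGroup H] [InnerProductSpace ℂ H] (f : ι → H) : Prop :=
  ∃ A B : ℝ, 0 < A ∧ 0 < B ∧ ∀ x : H,
    Summable (fun k => ‖inner ℂ (f k) x‖ ^ 2) ∧
    A * ‖x‖ ^ 2 ≤ ∑' k, ‖inner ℂ (f k) x‖ ^ 2 ∧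
    ∑' k, ‖inner ℂ (f k) x‖ ^ 2 ≤ B * ‖x‖ ^ 2

/-- `S` is the frame operator of the family `f`: `S x = ∑ k, ⟨x, f k⟩ f k` for every `x`. -/
def HasFrameOperator {ι H : Type*} [NormedAddCommGroup H] [InnerProductSpace ℂ H]
    (f : ι → H) (S : H →L[ℂ] H) : Prop :=
  ∀ x : H, HasSum (fun k => (inner ℂ (f k) x : ℂ) • f k) (S x)

/-- The pair `(S, c)` is *frame admissible* if there is a frame with frame operator `S` and squared
norms prescribed by `c`. -/
def FrameAdmissible {ι H : Type*} [NormedAddCommGroup H] [InnerProductSpace ℂ H]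
    (S : H →L[ℂ] H) (c : ι → ℝ) : Prop :=
  ∃ f : ι → H, IsFrame f ∧ HasFrameOperator f S ∧ ∀ k, ‖f k‖ ^ 2 = c k

/-- `seqU k a = sup { ∑ i ∈ F, a i : F a set of k indices }`. For a bounded sequence `a` this is the
supremum of a non-empty bounded set of real numbers. -/
noncomputable def seqU (k : ℕ) (a : ℕ → ℝ) : ℝ :=
  sSup {s : ℝ | ∃ F : Finset ℕ, F.card = k ∧ s = ∑ i ∈ F, a i}

/-! Necessity: the trace of `S` is the sum of the `‖f i‖ ^ 2`, and Ky Fan's inequality bounds any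
`k` of these by the `k` largest eigenvalues. Sufficiency: the vectors `√(b k) • u k`, with `u` an
eigenbasis, have frame operator `S`. Rotating two neighbours preserves the operator and splits off a
vector of norm prescribed by `c` (`exists_peelOff`). Peeling the largest norm first keeps
majorization, so any finite part of `c` is realized up to a remainder whose trace is the tail of
`c`. Compactness gives the infinite family (`exists_hasSum_of_majorized`). -/

section PeelOff

/-! ### Splitting off vectors of prescribed norm. -/

variable {E : Type*} [NormedAddCommGroup E] [InnerProductSpace ℂ E]

/-- A rotation in the plane of coefficients replaces two vectors by two others with the same frame
operator, one of which has a prescribed norm. -/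
theorem exists_rotated_pair (g h : E) {t : ℝ} (h₁ : ‖h‖ ^ 2 ≤ t) (h₂ : t ≤ ‖g‖ ^ 2) :
    ∃ p q : E, ‖p‖ ^ 2 = t ∧ ‖p‖ ^ 2 + ‖q‖ ^ 2 = ‖g‖ ^ 2 + ‖h‖ ^ 2 ∧
      ∀ x : E, (inner ℂ p x : ℂ) • p + (inner ℂ q x : ℂ) • q =
        (inner ℂ g x : ℂ) • g + (inner ℂ h x : ℂ) • h := by
  let F : ℝ → ℝ := fun θ => ‖((Real.cos θ : ℝ) : ℂ) • g + ((Real.sin θ : ℝ) : ℂ) • h‖ ^ 2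
  have hF : Continuous F := by fun_prop
  have ht : t ∈ Set.Icc (F (Real.pi / 2)) (F 0) := by
    simp only [F, Real.cos_pi_div_two, Real.sin_pi_div_two, Real.cos_zero, Real.sin_zero]
    simpa using ⟨h₁, h₂⟩
  obtain ⟨θ, -, hθ⟩ := intermediate_value_Icc' (by positivity) hF.continuousOn ht
  have hcs : ((Real.cos θ : ℝ) : ℂ) * (Real.cos θ : ℝ) + (Real.sin θ : ℝ) * (Real.sin θ : ℝ) = 1 := by
    have := Real.cos_sq_add_sin_sq θ
    norm_cast
    rw [← sq, ← sq, this]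
  refine ⟨((Real.cos θ : ℝ) : ℂ) • g + ((Real.sin θ : ℝ) : ℂ) • h,
    -((Real.sin θ : ℝ) : ℂ) • g + ((Real.cos θ : ℝ) : ℂ) • h, hθ, ?_, fun x => ?_⟩
  · have hn : ∀ y : E, ‖y‖ ^ 2 = (inner ℂ y y : ℂ).re := fun y => norm_sq_eq_re_inner (𝕜 := ℂ) y
    simp only [hn, ← Complex.add_re]
    congr 1
    simp only [inner_add_left, inner_add_right, inner_smul_left, inner_smul_right, map_neg,
      Complex.conj_ofReal]
    linear_combination (inner ℂ g g + inner ℂ h h : ℂ) * hcs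
  · simp only [inner_add_left, inner_smul_left, map_neg, Complex.conj_ofReal]
    generalize (inner ℂ g x : ℂ) = u at *
    generalize (inner ℂ h x : ℂ) = v at *
    generalize ((Real.cos θ : ℝ) : ℂ) = a at *
    generalize ((Real.sin θ : ℝ) : ℂ) = s at *
    linear_combination (norm := module) hcs • (u • g + v • h)

/-- Replacing the two consecutive terms `i`, `i + 1` of a sequence by one term `q`. -/
def mergeAt {α : Type*} (g : ℕ → α) (i : ℕ) (q : α) (k : ℕ) : α :=
  if k < i then g k else if k = i then q else g (k + 1)

theorem sum_mergeAt {α V : Type*} [AddCommGroup V] (φ : α → V) (g : ℕ → α) (i : ℕ) (p q : α)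
    (h : φ p + φ q = φ (g i) + φ (g (i + 1))) {m : ℕ} (hm : i < m) :
    φ p + ∑ k ∈ Finset.range m, φ (mergeAt g i q k) = ∑ k ∈ Finset.range (m + 1), φ (g k) := by
  induction m, hm using Nat.le_induction with
  | base =>
    have h₁ : ∑ k ∈ Finset.range i, φ (mergeAt g i q k) = ∑ k ∈ Finset.range i, φ (g k) :=
      Finset.sum_congr rfl fun k hk => by simp [mergeAt, Finset.mem_range.1 hk]
    rw [Finset.sum_range_succ, Finset.sum_range_succ, Finset.sum_range_succ, h₁]
    simp only [mergeAt, lt_irrefl, if_false, if_true]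
    rw [add_left_comm, h]
    abel
  | succ m hm ih =>
    rw [Finset.sum_range_succ, ← add_assoc, ih, Finset.sum_range_succ _ (m + 1)]
    have h₁ : ¬ m < i := by omega
    have h₂ : m ≠ i := by omega
    simp [mergeAt, h₁, h₂]

theorem sum_mergeAt_of_le {α V : Type*} [AddCommGroup V] (φ : α → V) (g : ℕ → α) (i : ℕ) (q : α)
    {m : ℕ} (hm : m ≤ i) :
    ∑ k ∈ Finset.range m, φ (mergeAt g i q k) = ∑ k ∈ Finset.range m, φ (g k) :=
  Finset.sum_congr rfl fun k hk => by
    have : k < i := (Finset.mem_range.1 hk).trans_le hm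
    simp [mergeAt, this]

/-- Rotate the neighbours whose squared norms straddle `t`. The leftover `q` has squared norm
between theirs, so the order survives. Partial sums ending before `q` consist of terms at least `t`;
the later ones lose exactly `t`. Hence the final dichotomy. -/
theorem exists_peelOff (g : ℕ → E) (hg : Antitone fun k => ‖g k‖ ^ 2) {M : ℕ}
    (hM : ∀ k, M ≤ k → g k = 0) {t : ℝ} (ht₀ : 0 ≤ t) (ht : t ≤ ‖g 0‖ ^ 2) :
    ∃ (p : E) (g' : ℕ → E), ‖p‖ ^ 2 = t ∧ (Antitone fun k => ‖g' k‖ ^ 2) ∧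
      (∀ k, M ≤ k → g' k = 0) ∧
      (∀ x : E, (inner ℂ p x : ℂ) • p + ∑ k ∈ Finset.range M, (inner ℂ (g' k) x : ℂ) • g' k =
        ∑ k ∈ Finset.range M, (inner ℂ (g k) x : ℂ) • g k) ∧
      (t + ∑ k ∈ Finset.range M, ‖g' k‖ ^ 2 = ∑ k ∈ Finset.range M, ‖g k‖ ^ 2) ∧
      ∀ k, k * t ≤ ∑ l ∈ Finset.range k, ‖g' l‖ ^ 2 ∨
        t + ∑ l ∈ Finset.range k, ‖g' l‖ ^ 2 = ∑ l ∈ Finset.range (k + 1), ‖g l‖ ^ 2 := by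
  have hex : ∃ j, ‖g j‖ ^ 2 ≤ t := ⟨M, by simpa [hM M le_rfl] using ht₀⟩
  classical
  have hmin := fun j => Nat.find_min hex (m := j)
  have hspec := Nat.find_spec hex
  rcases hj : Nat.find hex with _ | i
  · rw [hj] at hspec
    have heq : ‖g 0‖ ^ 2 = t := le_antisymm hspec ht
    refine ⟨g 0, fun k => g (k + 1), heq, fun a b hab => hg (Nat.succ_le_succ hab),
      fun k hk => hM _ (by omega), fun x => ?_, ?_, fun k => Or.inr ?_⟩
    · rw [add_comm, ← Finset.sum_range_succ' (fun k => (inner ℂ (g k) x : ℂ) • g k),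
        Finset.sum_range_succ, hM M le_rfl]
      simp
    · rw [← heq, add_comm, ← Finset.sum_range_succ' (fun k => ‖g k‖ ^ 2),
        Finset.sum_range_succ, hM M le_rfl]
      simp
    · rw [← heq, Finset.sum_range_succ', add_comm]
  · have h₁ : ‖g (i + 1)‖ ^ 2 ≤ t := by rwa [hj] at hspec
    have h₂ : t < ‖g i‖ ^ 2 := not_le.1 (hmin i (by omega))
    have hiM : i < M := by
      by_contra hcon
      rw [hM i (not_lt.1 hcon)] at h₂
      simp at h₂
      linarith
    obtain ⟨p, q, hp, hpq, hop⟩ := exists_rotated_pair (g i) (g (i + 1)) h₁ h₂.le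
    have hz : ∀ k, M ≤ k → mergeAt g i q k = 0 := fun k hk => by
      have h₃ : ¬ k < i := by omega
      have h₄ : k ≠ i := by omega
      simp [mergeAt, h₃, h₄, hM (k + 1) (by omega)]
    have hN := fun m => sum_mergeAt (fun y : E => ‖y‖ ^ 2) g i p q hpq (m := m)
    refine ⟨p, mergeAt g i q, hp, antitone_nat_of_succ_le fun k => ?_, hz, fun x => ?_, ?_,
      fun k => ?_⟩
    · have hk := hg (Nat.le_succ k)
      have hk' := hg (Nat.le_succ (k + 1))
      simp only [Nat.succ_eq_add_one] at hk hk'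
      rcases lt_trichotomy (k + 1) i with h | h | h
      · simpa [mergeAt, h, show k < i by omega] using hk
      · subst h
        simp only [mergeAt, lt_irrefl, if_false, if_true, Nat.lt_succ_self]
        linarith
      · rcases (Nat.lt_succ_iff_lt_or_eq.1 h) with h' | h'
        · simpa [mergeAt, show ¬ k < i by omega, show k ≠ i by omega, show ¬ k + 1 < i by omega,
            show k + 1 ≠ i by omega] using hk'
        · subst h'
          simp only [mergeAt, lt_irrefl, if_false, if_true, show ¬ i + 1 < i by omega,
            show i + 1 ≠ i by omega]
          linarith
    · rw [sum_mergeAt (fun y : E => (inner ℂ y x : ℂ) • y) g i p q (hop x) hiM,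
        Finset.sum_range_succ, hM M le_rfl]
      simp
    · rw [← hp, hN M hiM, Finset.sum_range_succ, hM M le_rfl]
      simp
    · rcases le_or_gt k i with hk | hk
      · left
        rw [sum_mergeAt_of_le (fun y : E => ‖y‖ ^ 2) g i q hk, ← nsmul_eq_mul]
        calc k • t = ∑ _l ∈ Finset.range k, t := by simp
          _ ≤ _ := Finset.sum_le_sum fun l hl =>
            h₂.le.trans (hg ((Finset.mem_range.1 hl).le.trans hk))
      · right
        rw [← hp, hN k hk]

/-- A finite family of norms which is weakly majorized by those of a sequence `g` can be realized
by vectors whose frame operator, together with that of a remainder, is the one of `g`. -/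
theorem exists_vectors_and_remainder {ι : Type*} (s : Finset ι) (c : ι → ℝ) {M : ℕ} :
    ∀ (g : ℕ → E), (∀ i ∈ s, 0 ≤ c i) → (Antitone fun k => ‖g k‖ ^ 2) → (∀ k, M ≤ k → g k = 0) →
    (∀ F ⊆ s, ∑ i ∈ F, c i ≤ ∑ k ∈ Finset.range F.card, ‖g k‖ ^ 2) →
    ∃ (f : ι → E) (r : ℕ → E), (∀ i ∈ s, ‖f i‖ ^ 2 = c i) ∧
      (∀ x : E, ∑ i ∈ s, (inner ℂ (f i) x : ℂ) • f i +
        ∑ k ∈ Finset.range M, (inner ℂ (r k) x : ℂ) • r k =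
        ∑ k ∈ Finset.range M, (inner ℂ (g k) x : ℂ) • g k) ∧
      ∑ i ∈ s, c i + ∑ k ∈ Finset.range M, ‖r k‖ ^ 2 = ∑ k ∈ Finset.range M, ‖g k‖ ^ 2 := by
  classical
  induction s using Finset.strongInduction with
  | H s ih =>
  intro g hc hg hM hF
  rcases s.eq_empty_or_nonempty with rfl | hs
  · exact ⟨0, g, by simp, by simp, by simp⟩
  -- Maximality of `c a` is what lets the alternative `k * t ≤ …` bound any `F`; the other
  -- alternative uses the hypothesis on `insert a F`.
  obtain ⟨a, ha, hmax⟩ := s.exists_max_image c hs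
  obtain ⟨p, g', hp, hg', hM', hop, hsum, hmaj⟩ := exists_peelOff g hg hM (hc a ha)
    (by simpa using hF {a} (by simpa using ha))
  obtain ⟨f, r, hf, hfr, hfrs⟩ := ih (s.erase a) (Finset.erase_ssubset ha) g'
    (fun i hi => hc i (Finset.mem_of_mem_erase hi)) hg' hM' (fun F hFs => by
      have haF : a ∉ F := fun h => Finset.notMem_erase a s (hFs h)
      have hFs' : F ⊆ s := hFs.trans (Finset.erase_subset _ _)
      rcases hmaj F.card with h | h
      · refine le_trans ?_ h
        rw [← nsmul_eq_mul]
        exact Finset.sum_le_card_nsmul _ _ _ fun i hi => hmax i (hFs' hi)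
      · have := hF (insert a F) (Finset.insert_subset ha hFs')
        rw [Finset.sum_insert haF, Finset.card_insert_of_notMem haF] at this
        linarith)
  refine ⟨Function.update f a p, r, fun i hi => ?_, fun x => ?_, ?_⟩
  · by_cases h : i = a
    · subst h; simpa using hp
    · simpa [h] using hf i (Finset.mem_erase.2 ⟨h, hi⟩)
  · rw [← hop, ← hfr, ← Finset.add_sum_erase _ _ ha, Function.update_self, add_assoc]
    congr 2
    refine Finset.sum_congr rfl fun i hi => ?_
    rw [Function.update_of_ne (Finset.ne_of_mem_erase hi)]
  · rw [← Finset.add_sum_erase _ _ ha]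
    linarith

end PeelOff

/-! ### Passage to infinitely many vectors. -/

section Limit

variable {E : Type*} [NormedAddCommGroup E] [InnerProductSpace ℂ E]

theorem norm_inner_smul_self_le (y x : E) : ‖(inner ℂ y x : ℂ) • y‖ ≤ ‖y‖ ^ 2 * ‖x‖ := by
  rw [norm_smul]
  nlinarith [norm_inner_le_norm (𝕜 := ℂ) y x, norm_nonneg y]

open Filter Topology in
/-- An infinite Schur–Horn theorem: norms which are majorized by those of a finite sequence `g` are
realized by a sequence of vectors with the same frame operator as `g`. -/
theorem exists_hasSum_of_majorized [FiniteDimensional ℂ E] (c : ℕ → ℝ) (hc : ∀ i, 0 ≤ c i)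
    (g : ℕ → E) (hg : Antitone fun k => ‖g k‖ ^ 2) {M : ℕ} (hM : ∀ k, M ≤ k → g k = 0)
    (hF : ∀ F : Finset ℕ, ∑ i ∈ F, c i ≤ ∑ k ∈ Finset.range F.card, ‖g k‖ ^ 2)
    (hsum : HasSum c (∑ k ∈ Finset.range M, ‖g k‖ ^ 2)) :
    ∃ f : ℕ → E, (∀ i, ‖f i‖ ^ 2 = c i) ∧
      ∀ x : E, HasSum (fun i => (inner ℂ (f i) x : ℂ) • f i)
        (∑ k ∈ Finset.range M, (inner ℂ (g k) x : ℂ) • g k) := by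
  have : ProperSpace E := FiniteDimensional.proper ℂ E
  have : CompleteSpace E := FiniteDimensional.complete ℂ E
  choose f r hf hfr hfrs using fun N : ℕ =>
    exists_vectors_and_remainder (Finset.range N) c g (fun i _ => hc i) hg hM (fun F _ => hF F)
  -- Along an ultrafilter all coordinates, bounded by `√(c i)`, converge at once, without a diagonal
  -- subsequence.
  let U : Ultrafilter ℕ := Ultrafilter.of atTop
  have hU : (U : Filter ℕ) ≤ atTop := Ultrafilter.of_le atTop
  have hnorm : ∀ i, ∀ᶠ N in (U : Filter ℕ), ‖f N i‖ ^ 2 = c i := fun i =>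
    hU ((eventually_gt_atTop i).mono fun N hN => hf N i (Finset.mem_range.2 hN))
  have hlim : ∀ i, ∃ y, Tendsto (fun N => f N i) U (𝓝 y) := fun i => by
    obtain ⟨y, -, hy⟩ := (isCompact_closedBall (0 : E) (√(c i))).ultrafilter_le_nhds
      (U.map fun N => f N i) (by
        rw [le_principal_iff]
        exact (hnorm i).mono fun N hN => by
          simpa using Real.le_sqrt_of_sq_le hN.le)
    exact ⟨y, hy⟩
  choose y hy using hlim
  have hyc : ∀ i, ‖y i‖ ^ 2 = c i := fun i =>
    tendsto_nhds_unique ((hy i).norm.pow 2)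
      (tendsto_const_nhds.congr' ((hnorm i).mono fun N hN => hN.symm))
  refine ⟨y, hyc, fun x => ?_⟩
  have hbound : Summable fun i => c i * ‖x‖ := hsum.summable.mul_right _
  have hsy : Summable fun i => (inner ℂ (y i) x : ℂ) • y i :=
    Summable.of_norm_bounded hbound fun i => by
      rw [← hyc i]; exact norm_inner_smul_self_le _ _
  have h₁ : Tendsto (fun N => ∑' i, if i < N then (inner ℂ (f N i) x : ℂ) • f N i else 0) U
      (𝓝 (∑' i, (inner ℂ (y i) x : ℂ) • y i)) := by
    refine tendsto_tsum_of_dominated_convergence hbound (fun i => ?_)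
      (Eventually.of_forall fun N i => ?_)
    · refine (((hy i).inner tendsto_const_nhds).smul (hy i)).congr' ?_
      exact hU ((eventually_gt_atTop i).mono fun N hN => by simp [hN])
    · split_ifs with h
      · rw [← hf N i (Finset.mem_range.2 h)]; exact norm_inner_smul_self_le _ _
      · simpa using mul_nonneg (hc i) (norm_nonneg x)
  have h₂ : ∀ N, ∑' i, (if i < N then (inner ℂ (f N i) x : ℂ) • f N i else 0) =
      ∑ i ∈ Finset.range N, (inner ℂ (f N i) x : ℂ) • f N i := fun N => by
    rw [tsum_eq_sum (s := Finset.range N) fun i hi => if_neg (by simpa using hi)]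
    exact Finset.sum_congr rfl fun i hi => if_pos (Finset.mem_range.1 hi)
  simp only [h₂] at h₁
  -- The remainder operator is bounded by its trace, a tail of the series of `c`.
  have hr : Tendsto (fun N => ∑ k ∈ Finset.range M, (inner ℂ (r N k) x : ℂ) • r N k) atTop
      (𝓝 0) := by
    have h₃ : Tendsto (fun N => ((∑ k ∈ Finset.range M, ‖g k‖ ^ 2) - ∑ i ∈ Finset.range N, c i) *
        ‖x‖) atTop (𝓝 0) := by
      have h₅ := ((tendsto_const_nhds (x := ∑ k ∈ Finset.range M, ‖g k‖ ^ 2)).sub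
        hsum.tendsto_sum_nat).mul_const ‖x‖
      rwa [sub_self, zero_mul] at h₅
    refine squeeze_zero_norm (fun N => ?_) h₃
    rw [← hfrs N, add_sub_cancel_left, Finset.sum_mul]
    exact norm_sum_le_of_le _ fun k _ => norm_inner_smul_self_le _ _
  have h₄ := h₁.add (hr.mono_left hU)
  simp only [hfr, add_zero] at h₄
  rw [tendsto_nhds_unique tendsto_const_nhds h₄]
  exact hsy.hasSum

end Limit

/-! ### Extremal weights and an ordered eigenbasis. -/

/-- The maximum of a linear functional with antitone coefficients over weights in `[0, 1]` of total
mass at most `k`. -/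
theorem sum_mul_le_sum_filter_lt {n k : ℕ} (hk : k < n) {b w : Fin n → ℝ} (hb : Antitone b)
    (hb₀ : ∀ i, 0 ≤ b i) (hw₀ : ∀ i, 0 ≤ w i) (hw₁ : ∀ i, w i ≤ 1) (hw : ∑ i, w i ≤ k) :
    ∑ i, b i * w i ≤ ∑ i ∈ Finset.univ.filter (fun i : Fin n => (i : ℕ) < k), b i := by
  have hcard : (Finset.univ.filter (fun i : Fin n => (i : ℕ) < k)).card = k := by
    rw [Fin.card_filter_val_lt, min_eq_right hk.le]
  -- After subtracting the threshold `b k`, the coefficients are nonnegative below `k` and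
  -- nonpositive from `k` on, so the indicator of `i < k` is the best weight.
  have h : ∑ i, (b i - b ⟨k, hk⟩) * w i ≤
      ∑ i ∈ Finset.univ.filter (fun i : Fin n => (i : ℕ) < k), (b i - b ⟨k, hk⟩) := by
    rw [Finset.sum_filter]
    refine Finset.sum_le_sum fun i _ => ?_
    split_ifs with hi
    · have : b ⟨k, hk⟩ ≤ b i := hb (Fin.le_def.2 hi.le)
      exact mul_le_of_le_one_right (by linarith) (hw₁ i)
    · have : b i ≤ b ⟨k, hk⟩ := hb (Fin.le_def.2 (not_lt.1 hi))
      exact mul_nonpos_of_nonpos_of_nonneg (by linarith) (hw₀ i)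
  rw [Finset.sum_sub_distrib, Finset.sum_const, hcard, nsmul_eq_mul] at h
  simp only [sub_mul, Finset.sum_sub_distrib, ← Finset.mul_sum] at h
  nlinarith [mul_le_mul_of_nonneg_left hw (hb₀ ⟨k, hk⟩)]

theorem exists_orthonormalBasis_eigenvectors {n : ℕ} {S : Matrix (Fin n) (Fin n) ℂ}
    (hS : S.IsHermitian) {b : Fin n → ℝ} (hb : Antitone b)
    (hbS : S.charpoly.roots = Multiset.map (fun i => (b i : ℂ)) Finset.univ.val) :
    ∃ u : OrthonormalBasis (Fin n) ℂ (EuclideanSpace ℂ (Fin n)),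
      ∀ j, Matrix.toEuclideanCLM (𝕜 := ℂ) S (u j) = (b j : ℂ) • u j := by
  have hT := Matrix.isSymmetric_toEuclideanLin_iff.mpr hS
  have hn : Module.finrank ℂ (EuclideanSpace ℂ (Fin n)) = n := finrank_euclideanSpace_fin
  have hchar : (Matrix.toEuclideanLin S).charpoly = S.charpoly := by
    rw [Matrix.toEuclideanLin, Matrix.toLpLin_eq_toLin, Matrix.charpoly_toLin]
  -- Two decreasing lists with the same multiset of entries coincide.
  have heq : b = hT.eigenvalues hn := by
    rw [← List.ofFn_inj, ← hT.sort_roots_charpoly_eq_eigenvalues hn, hchar, hbS, Fin.univ_val_map,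
      Multiset.map_coe, List.map_ofFn, Multiset.coe_sort]
    symm
    simp only [Function.comp_def, RCLike.re_eq_complex_re, Complex.ofReal_re]
    apply List.mergeSort_of_pairwise
    simp_rw [decide_eq_true_eq, ← List.sortedGE_iff_pairwise]
    exact hb.sortedGE_ofFn
  refine ⟨hT.eigenvectorBasis hn, fun j => ?_⟩
  rw [heq]
  exact hT.apply_eigenvectorBasis hn j

/-! ### Trace and Ky Fan bounds for frame operators. -/

section FrameOperator

variable {E : Type*} [NormedAddCommGroup E] [InnerProductSpace ℂ E]

theorem apply_eq_sum_of_eigenvectors {ι : Type*} [Fintype ι] {T : E →L[ℂ] E}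
    (u : OrthonormalBasis ι ℂ E) {b : ι → ℝ} (hu : ∀ j, T (u j) = (b j : ℂ) • u j) (x : E) :
    T x = ∑ j, ((b j : ℂ) * inner ℂ (u j) x) • u j := by
  conv_lhs => rw [← u.sum_repr' x, map_sum]
  refine Finset.sum_congr rfl fun j _ => ?_
  rw [map_smul, hu, smul_smul, mul_comm]

theorem re_inner_apply_of_eigenvectors {ι : Type*} [Fintype ι] {T : E →L[ℂ] E}
    (u : OrthonormalBasis ι ℂ E) {b : ι → ℝ} (hu : ∀ j, T (u j) = (b j : ℂ) • u j) (x : E) :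
    (inner ℂ x (T x) : ℂ).re = ∑ j, b j * ‖inner ℂ (u j) x‖ ^ 2 := by
  rw [apply_eq_sum_of_eigenvectors u hu, inner_sum, Complex.re_sum]
  refine Finset.sum_congr rfl fun j _ => ?_
  rw [inner_smul_right, mul_assoc, Complex.re_ofReal_mul, ← inner_conj_symm x (u j),
    Complex.mul_conj, Complex.ofReal_re, Complex.normSq_eq_norm_sq]

theorem HasFrameOperator.hasSum_norm_inner_sq {ι : Type*} {f : ι → E} {T : E →L[ℂ] E}
    (h : HasFrameOperator f T) (x : E) :
    HasSum (fun k => ‖inner ℂ (f k) x‖ ^ 2) (inner ℂ x (T x) : ℂ).re := by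
  have h₁ := Complex.hasSum_re (((innerSL ℂ x).hasSum (h x)))
  simp only [innerSL_apply_apply] at h₁
  convert h₁ using 2 with k
  rw [inner_smul_right, ← inner_conj_symm x (f k), Complex.mul_conj, Complex.ofReal_re,
    Complex.normSq_eq_norm_sq]

theorem HasFrameOperator.isFrame {ι κ : Type*} [Fintype κ] {f : ι → E} {T : E →L[ℂ] E}
    (h : HasFrameOperator f T) (u : OrthonormalBasis κ ℂ E) {b : κ → ℝ}
    (hu : ∀ j, T (u j) = (b j : ℂ) • u j) (hb : ∀ j, 0 < b j) : IsFrame f := by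
  obtain ⟨A, hA, hAb⟩ : ∃ A : ℝ, 0 < A ∧ ∀ j, A ≤ b j := by
    rcases isEmpty_or_nonempty κ with hκ | hκ
    · exact ⟨1, one_pos, fun j => hκ.elim j⟩
    · obtain ⟨j, hj⟩ := Finite.exists_min b
      exact ⟨b j, hb j, hj⟩
  -- The summand `1` keeps the upper bound positive even when `κ` is empty.
  have hbB : ∀ j, b j ≤ 1 + ∑ i, b i := fun j =>
    (Finset.single_le_sum (fun i _ => (hb i).le) (Finset.mem_univ j)).trans (by simp)
  refine ⟨A, 1 + ∑ i, b i, hA, add_pos_of_pos_of_nonneg one_pos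
    (Finset.sum_nonneg fun i _ => (hb i).le), fun x => ?_⟩
  have hx := h.hasSum_norm_inner_sq x
  rw [re_inner_apply_of_eigenvectors u hu] at hx
  refine ⟨hx.summable, ?_, ?_⟩ <;>
    rw [hx.tsum_eq, ← u.sum_sq_norm_inner_right x, Finset.mul_sum] <;>
    exact Finset.sum_le_sum fun j _ => by
      gcongr
      first | exact hAb j | exact hbB j

/-- Compute the trace of `T` in the basis `u`, then apply Parseval to each `f k`. -/
theorem HasFrameOperator.hasSum_norm_sq {ι κ : Type*} [Fintype κ] {f : ι → E} {T : E →L[ℂ] E}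
    (h : HasFrameOperator f T) (u : OrthonormalBasis κ ℂ E) {b : κ → ℝ}
    (hu : ∀ j, T (u j) = (b j : ℂ) • u j) : HasSum (fun k => ‖f k‖ ^ 2) (∑ j, b j) := by
  have h₁ := hasSum_sum (s := Finset.univ) fun j _ => h.hasSum_norm_inner_sq (u j)
  simp only [u.sum_sq_norm_inner_left] at h₁
  convert h₁ using 2 with j
  simp [hu]

/-- Ky Fan's inequality for the partial sums of squared norms of a frame. -/
theorem HasFrameOperator.sum_norm_sq_le {ι : Type*} {n : ℕ} {f : ι → E} {T : E →L[ℂ] E}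
    (h : HasFrameOperator f T) (u : OrthonormalBasis (Fin n) ℂ E) {b : Fin n → ℝ}
    (hu : ∀ j, T (u j) = (b j : ℂ) • u j) (hb : Antitone b) (hb₀ : ∀ j, 0 ≤ b j)
    (F : Finset ι) (hF : F.card < n) :
    ∑ i ∈ F, ‖f i‖ ^ 2 ≤ ∑ i ∈ Finset.univ.filter (fun i : Fin n => (i : ℕ) < F.card), b i := by
  classical
  -- In an orthonormal basis `e` of `V`, the weight of `b j` is the squared norm of the projection
  -- of `u j` to `V`: at most 1 by Bessel, with total `dim V ≤ F.card`.
  let V : Submodule ℂ E := Submodule.span ℂ (F.image f : Set E)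
  have : FiniteDimensional ℂ V := FiniteDimensional.span_finset ℂ _
  have hd : Module.finrank ℂ V ≤ F.card :=
    (finrank_span_finset_le_card (R := ℂ) (F.image f)).trans Finset.card_image_le
  let e := stdOrthonormalBasis ℂ V
  have he : Orthonormal ℂ fun l => (e l : E) := e.orthonormal.comp_linearIsometry V.subtypeₗᵢ
  have hfV : ∀ i ∈ F, f i ∈ V := fun i hi =>
    Submodule.subset_span (by simpa using ⟨i, hi, rfl⟩)
  have h₁ : ∀ i ∈ F, ‖f i‖ ^ 2 = ∑ l, ‖inner ℂ (f i) (e l : E)‖ ^ 2 := fun i hi =>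
    (e.sum_sq_norm_inner_left ⟨f i, hfV i hi⟩).symm
  calc ∑ i ∈ F, ‖f i‖ ^ 2 = ∑ l, ∑ i ∈ F, ‖inner ℂ (f i) (e l : E)‖ ^ 2 := by
        rw [Finset.sum_congr rfl h₁, Finset.sum_comm]
    _ ≤ ∑ l, ∑ j, b j * ‖inner ℂ (u j) (e l : E)‖ ^ 2 := Finset.sum_le_sum fun l _ => by
        rw [← re_inner_apply_of_eigenvectors u hu]
        exact sum_le_hasSum F (fun _ _ => by positivity) (h.hasSum_norm_inner_sq _)
    _ = ∑ j, b j * ∑ l, ‖inner ℂ (u j) (e l : E)‖ ^ 2 := by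
        rw [Finset.sum_comm]; simp only [Finset.mul_sum]
    _ ≤ _ := by
        refine sum_mul_le_sum_filter_lt hF hb hb₀ (fun j => by positivity) (fun j => ?_) ?_
        · simp only [norm_inner_symm (u j)]
          simpa using he.sum_inner_products_le (u j) (s := Finset.univ)
        · rw [Finset.sum_comm]
          simp only [u.sum_sq_norm_inner_right, he.norm_eq_one]
          simpa using hd

end FrameOperator

/-! ### Suprema of finite sums and the equivalence. -/

theorem seqU_le_iff {k : ℕ} {c : ℕ → ℝ} (hcb : BddAbove (Set.range c)) {a : ℝ} :
    seqU k c ≤ a ↔ ∀ F : Finset ℕ, F.card = k → ∑ i ∈ F, c i ≤ a := by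
  obtain ⟨B, hB⟩ := hcb
  -- Needed because `sSup` of an unbounded set of reals is 0 by convention.
  have hbdd : BddAbove {s : ℝ | ∃ F : Finset ℕ, F.card = k ∧ s = ∑ i ∈ F, c i} := by
    refine ⟨k • B, ?_⟩
    rintro _ ⟨F, rfl, rfl⟩
    exact Finset.sum_le_card_nsmul _ _ _ fun i _ => hB ⟨i, rfl⟩
  rw [seqU, csSup_le_iff hbdd ⟨_, Finset.range k, Finset.card_range k, rfl⟩]
  exact ⟨fun h F hF => h _ ⟨F, hF, rfl⟩, by rintro h _ ⟨F, hF, rfl⟩; exact h F hF⟩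

theorem theorem4p7 (n : ℕ) (S : Matrix (Fin n) (Fin n) ℂ) (hS : S.PosDef)
    (b : Fin n → ℝ) (hb : Antitone b)
    (hbS : S.charpoly.roots = Multiset.map (fun i => (b i : ℂ)) Finset.univ.val)
    (c : ℕ → ℝ) (hc : ∀ i, 0 ≤ c i) (hcb : BddAbove (Set.range c)) :
    FrameAdmissible (Matrix.toEuclideanCLM (𝕜 := ℂ) S) c ↔
      (∀ k : ℕ, 1 ≤ k → k < n →
        seqU k c ≤ ∑ i ∈ Finset.univ.filter (fun i : Fin n => (i : ℕ) < k), b i) ∧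
      HasSum c (∑ i, b i) := by
  obtain ⟨u, hu⟩ := exists_orthonormalBasis_eigenvectors hS.isHermitian hb hbS
  have hpos : ∀ j, 0 < b j := fun j => by
    have h₀ : (b j : ℂ) ∈ S.charpoly.roots := by
      rw [hbS]; exact Multiset.mem_map_of_mem _ (Finset.mem_univ j)
    rw [hS.isHermitian.roots_charpoly_eq_eigenvalues] at h₀
    obtain ⟨i, -, hi⟩ := Multiset.mem_map.1 h₀
    have hi' : hS.isHermitian.eigenvalues i = b j := by simpa using hi
    exact hi' ▸ hS.eigenvalues_pos i
  constructor
  · rintro ⟨f, -, hfS, hfc⟩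
    refine ⟨fun k _ hk => (seqU_le_iff hcb).2 ?_, ?_⟩
    · rintro F rfl
      simpa only [hfc] using hfS.sum_norm_sq_le u hu hb (fun j => (hpos j).le) F hk
    · simpa only [hfc] using hfS.hasSum_norm_sq u hu
  · rintro ⟨hk, hsum⟩
    let g : ℕ → EuclideanSpace ℂ (Fin n) := fun k =>
      if h : k < n then ((√(b ⟨k, h⟩) : ℝ) : ℂ) • u ⟨k, h⟩ else 0
    have hgnorm : ∀ k, ‖g k‖ ^ 2 = if h : k < n then b ⟨k, h⟩ else 0 := fun k => by
      by_cases h : k < n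
      · simp [g, h, norm_smul, Real.sq_sqrt (hpos _).le]
      · simp [g, h]
    have hg : Antitone fun k => ‖g k‖ ^ 2 := fun k l hkl => by
      simp only [hgnorm]
      split_ifs with h₁ h₂ h₂
      · exact hb (Fin.le_def.2 hkl)
      · omega
      · exact (hpos _).le
      · rfl
    have hM : ∀ k, n ≤ k → g k = 0 := fun k h => dif_neg (not_lt.2 h)
    have hpart : ∀ m, m ≤ n → ∑ k ∈ Finset.range m, ‖g k‖ ^ 2 =
        ∑ i ∈ Finset.univ.filter (fun i : Fin n => (i : ℕ) < m), b i := fun m hm => by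
      have : ∀ i : Fin n, ‖g i‖ ^ 2 = b i := fun i => by simp [hgnorm]
      simp only [← this]
      rw [Finset.sum_filter, Fin.sum_univ_eq_sum_range (fun k => if k < m then ‖g k‖ ^ 2 else 0),
        ← Finset.sum_filter]
      congr 1
      ext k
      simp; omega
    have htotal : ∑ k ∈ Finset.range n, ‖g k‖ ^ 2 = ∑ i, b i := by
      rw [hpart n le_rfl]; simp
    obtain ⟨f, hfc, hfS⟩ := exists_hasSum_of_majorized c hc g hg hM (fun F => by
      rcases F.eq_empty_or_nonempty with rfl | hne
      · simp
      rcases lt_or_ge F.card n with hF | hF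
      · rw [hpart _ hF.le]
        exact (seqU_le_iff hcb).1 (hk F.card hne.card_pos hF) F rfl
      -- For `n` or more indices the trace identity alone suffices, as `c` is nonnegative.
      · refine (sum_le_hasSum F (fun i _ => hc i) hsum).trans ?_
        rw [← htotal]
        exact Finset.sum_le_sum_of_subset_of_nonneg (Finset.range_mono hF)
          fun _ _ _ => by positivity) (by rwa [htotal])
    have hop : HasFrameOperator f (Matrix.toEuclideanCLM (𝕜 := ℂ) S) := fun x => by
      convert hfS x using 1
      rw [apply_eq_sum_of_eigenvectors u hu,
        ← Fin.sum_univ_eq_sum_range (fun k => (inner ℂ (g k) x : ℂ) • g k)]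
      refine Finset.sum_congr rfl fun j _ => ?_
      have hsq : ((√(b j) : ℝ) : ℂ) * (√(b j) : ℝ) = b j := by
        norm_cast; exact Real.mul_self_sqrt (hpos j).le
      simp only [g, j.isLt, dif_pos, Fin.eta, inner_smul_left, Complex.conj_ofReal, smul_smul]
      rw [← hsq]
      ring_nf
    exact ⟨f, hop.isFrame u hu hpos, hop, hfc⟩
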